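/- An integral convex polytope in $\mathbb{R}^N$ is the convex hull of a nonempty finite set of points of $\mathbb{Z}^N$. Such a polytope $P$ has the integer decomposition property (IDP) if for every integer $k\ge 1$ each point of $kP\cap\mathbb{Z}^N$ is a sum of $k$ points of $P\cap\mathbb{Z}^N$. Let $\mu_{\mathrm{midp}}(P)$ be the smallest integer $k>0$ such that $kP$ has (IDP), and let $\mu_{\mathrm{idp}}(P)$ be the smallest integer $k>0$ such that $nP$ has (IDP) for all integers $n\ge k$. Let $C(P)\subset\mathbb{R}^{N+1}$ be the cone generated by the vertices of $\{(\alpha,1):\alpha\in P\}$. A Hilbert basis of $C(P)$ is a finite set of integer vectors whose nonnegative integer combinations are exactly the points of $C(P)\cap\mathbb{Z}^{N+1}$; there is a unique minimal one, contained in all others. Let $\mu_{\mathrm{Hilb}}(P)$ be the maximal degree of its elements, where the degree of $(\alpha,n)$ is $n$. Theorem. For every integer $d\ge 4$ there is an integral convex polytope $P\subset\mathbb{R}^d$ of dimension $d$ with $$\mu_{\mathrm{Hilb}}(P)=d-1\qquad\text{and}\qquad \mu_{\mathrm{midp}}(P)=\mu_{\mathrm{idp}}(P)=d-2 .$$ Explicitly,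 with $e_1,\dots,e_d$ the standard unit vectors of $\mathbb{R}^d$ and $M=d(d-2)+1$, one can take $P$ to be the convex hull of the points $v_0,\dots,v_d$ and $v_0+e_d,\dots,v_d+e_d$, where $v_0=0$, $v_j=e_j$ for $1\le j\le d-1$, and $v_d=e_1+\cdots+e_{d-1}+M e_d$. -/

import Mathlib

open scoped Pointwise

/-- The integer vector `α ∈ ℤ^N`, viewed in `ℝ^N`. -/
def toRealVec {N : ℕ} (α : Fin N → ℤ) : Fin N → ℝ := fun i => (α i : ℝ)

/-- `P ⊆ ℝ^N` is an integral convex polytope: the convex hull of a nonempty finite set of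
integer points. -/
def IsIntegralPolytope {N : ℕ} (P : Set (Fin N → ℝ)) : Prop :=
  ∃ S : Finset (Fin N → ℤ), S.Nonempty ∧
    P = convexHull ℝ (toRealVec '' (S : Set (Fin N → ℤ)))

/-- The dimension of a (nonempty) polytope: the dimension of its affine hull. -/
noncomputable def polytopeDim {N : ℕ} (P : Set (Fin N → ℝ)) : ℕ :=
  Module.finrank ℝ (vectorSpan ℝ P)

/-- The integer decomposition property (IDP): for every `k ≥ 1`, each integer point of the
dilation `k P` is a sum of `k` integer points of `P`. -/
def HasIDP {N : ℕ} (P : Set (Fin N → ℝ)) : Prop :=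
  ∀ k : ℕ, 1 ≤ k → ∀ α : Fin N → ℤ, toRealVec α ∈ (k : ℝ) • P →
    ∃ β : Fin k → (Fin N → ℤ), (∀ i, toRealVec (β i) ∈ P) ∧ α = ∑ i, β i

/-- `k = μ_midp(P)`: the smallest integer `k > 0` such that `k P` has (IDP). -/
def IsMuMidp {N : ℕ} (P : Set (Fin N → ℝ)) (k : ℕ) : Prop :=
  IsLeast {k : ℕ | 0 < k ∧ HasIDP ((k : ℝ) • P)} k

/-- `k = μ_idp(P)`: the smallest integer `k > 0` such that `n P` has (IDP) for all `n ≥ k`. -/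
def IsMuIdp {N : ℕ} (P : Set (Fin N → ℝ)) (k : ℕ) : Prop :=
  IsLeast {k : ℕ | 0 < k ∧ ∀ n : ℕ, k ≤ n → HasIDP ((n : ℝ) • P)} k

/-- The lifted polytope `{(α, 1) : α ∈ P}` in `ℝ^(N+1) = ℝ^N × ℝ`. -/
def liftedPolytope {N : ℕ} (P : Set (Fin N → ℝ)) : Set ((Fin N → ℝ) × ℝ) :=
  (fun α => (α, (1 : ℝ))) '' P

/-- The cone `C(P)` generated by the vertices of the lifted polytope. -/
def polytopeCone {N : ℕ} (P : Set (Fin N → ℝ)) : PointedCone ℝ ((Fin N → ℝ) × ℝ) :=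
  PointedCone.hull ℝ ((liftedPolytope P).extremePoints ℝ)

/-- The integer points `C ∩ ℤ^(N+1)` of a cone `C ⊆ ℝ^(N+1)`. -/
def coneIntegerPoints {N : ℕ} (C : PointedCone ℝ ((Fin N → ℝ) × ℝ)) :
    Set ((Fin N → ℤ) × ℤ) :=
  {z | (toRealVec z.1, (z.2 : ℝ)) ∈ C}

/-- The finite set `H ⊆ ℤ^(N+1)` is a Hilbert basis of `C`: the nonnegative integer
combinations of elements of `H` are exactly the integer points of `C`. -/
def IsHilbertBasis {N : ℕ} (C : PointedCone ℝ ((Fin N → ℝ) × ℝ))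
    (H : Finset ((Fin N → ℤ) × ℤ)) : Prop :=
  coneIntegerPoints C = (AddSubmonoid.closure (H : Set ((Fin N → ℤ) × ℤ)) : Set _)

/-- `H` is the minimal Hilbert basis of `C`: it is a Hilbert basis, and it is contained in
every Hilbert basis of `C`. -/
def IsMinimalHilbertBasis {N : ℕ} (C : PointedCone ℝ ((Fin N → ℝ) × ℝ))
    (H : Finset ((Fin N → ℤ) × ℤ)) : Prop :=
  IsLeast {H : Finset ((Fin N → ℤ) × ℤ) | IsHilbertBasis C H} H

/-- `m = μ_Hilb(P)`: the maximal degree (last coordinate) of an element of the minimal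
Hilbert basis of `C(P)`. -/
def IsMuHilb {N : ℕ} (P : Set (Fin N → ℝ)) (m : ℕ) : Prop :=
  ∃ H : Finset ((Fin N → ℤ) × ℤ), IsMinimalHilbertBasis (polytopeCone P) H ∧
    IsGreatest {n : ℤ | ∃ h ∈ H, h.2 = n} (m : ℤ)

/-- The unit vector `e_j ∈ ℤ^d`, with coordinates numbered `1, …, d`. -/
def unitVec (d j : ℕ) : Fin d → ℤ := fun i => if (i : ℕ) + 1 = j then 1 else 0

/-- The points `v_0 = 0`, `v_j = e_j` for `1 ≤ j ≤ d - 1`, and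
`v_d = e_1 + ⋯ + e_(d-1) + M e_d`, where `M = d (d - 2) + 1`. -/
def prismPoint (d j : ℕ) : Fin d → ℤ :=
  if j = 0 then 0
  else if j < d then unitVec d j
  else (∑ i ∈ Finset.Icc 1 (d - 1), unitVec d i) + ((d : ℤ) * ((d : ℤ) - 2) + 1) • unitVec d d

/-- The prism-like polytope: the convex hull of `v_0, …, v_d` and `v_0 + e_d, …, v_d + e_d`. -/
def prismPolytope (d : ℕ) : Set (Fin d → ℝ) :=
  convexHull ℝ {x | ∃ j : ℕ, j ≤ d ∧
    (x = toRealVec (prismPoint d j) ∨ x = toRealVec (prismPoint d j + unitVec d d))}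

/-! Put `n = d - 1`, so that `M = n ^ 2`. A point of degree `K` in the cone has base `x`, last
coordinate `y` and coordinate sum `S` of `x`. Let `t` be the total weight on `v_d` and `v_d + e_d`.
The other weights force `0 ≤ t ≤ x_i` and `S - K ≤ (n - 1) t`, and the prism direction forces `0 ≤ y
- n ^ 2 t ≤ K`. Eliminating `t` (Fourier–Motzkin) leaves the inequalities of `PrismCone`.

Positive side: subtracting a suitable vertex splits off a lattice point of degree one, except
possibly over the base `(1, …, 1)` in degree at most `n` (`exists_sub_mem_or`). In degree `n` the
only exception is `y = n + 1`. Hence irreducibles have degree at most `n`, and degrees `k, l ≥ n -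
1` always split (`exists_add_of_le`), because `k + l > n`.

Negative side: a lattice point of degree `K` with a zero base coordinate has `y ≤ K`; any other has
`(n - 1) y ≥ n ^ 2 (n - K)` (`last_le_or_le_last`). As `n ^ 2 / (n - 1) > n + 1`, the point `(1, …,
1, n + 1)` of degree `n` is irreducible. The same gap rules out (IDP) for `k P` when `k ≤ n - 2`. -/

/-- The inequalities, in coordinates `x = (X_1, …, X_n)` and `y = X_(n+1)`, that cut out the
degree `K` slice of the cone over `prismPolytope (n + 1)`. -/
structure PrismCone {R : Type*} [CommRing R] [LinearOrder R] {n : ℕ}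
    (X : Fin (n + 1) → R) (K : R) : Prop where
  base_nonneg : ∀ i : Fin n, 0 ≤ X i.castSucc
  sum_le : ∀ i : Fin n, ∑ j : Fin n, X j.castSucc ≤ ((n : R) - 1) * X i.castSucc + K
  last_nonneg : 0 ≤ X (Fin.last n)
  last_le : ∀ i : Fin n, X (Fin.last n) ≤ (n : R) ^ 2 * X i.castSucc + K
  le_last : (n : R) ^ 2 * (∑ j : Fin n, X j.castSucc - K) ≤ ((n : R) - 1) * X (Fin.last n)

namespace PrismCone

theorem add_single_last {R : Type*} [CommRing R] [LinearOrder R] {n : ℕ}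
    {X : Fin (n + 1) → R} {K : R} (hX : PrismCone X K) {c : R}
    (h0 : 0 ≤ X (Fin.last n) + c)
    (hu : ∀ i : Fin n, X (Fin.last n) + c ≤ (n : R) ^ 2 * X i.castSucc + K)
    (hle : (n : R) ^ 2 * (∑ j : Fin n, X j.castSucc - K) ≤ ((n : R) - 1) * (X (Fin.last n) + c)) :
    PrismCone (X + Pi.single (Fin.last n) c) K := by
  have h (i : Fin n) : (Pi.single (Fin.last n) c : Fin (n + 1) → R) i.castSucc = 0 := by
    simp
  constructor <;> simp only [Pi.add_apply, h, add_zero, Pi.single_eq_same]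
  exacts [hX.base_nonneg, hX.sum_le, h0, hu, hle]

/-! ### Cone operations and the vertices of the prism. -/

section Ordered

variable {R : Type*} [CommRing R] [LinearOrder R] [IsStrictOrderedRing R] {n : ℕ}

theorem add {X Y : Fin (n + 1) → R} {K L : R} (hX : PrismCone X K) (hY : PrismCone Y L) :
    PrismCone (X + Y) (K + L) where
  base_nonneg i := by
    have := hX.base_nonneg i; have := hY.base_nonneg i
    simp only [Pi.add_apply]; linarith
  sum_le i := by
    have := hX.sum_le i; have := hY.sum_le i
    simp only [Pi.add_apply, Finset.sum_add_distrib]; linarith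
  last_nonneg := by
    have := hX.last_nonneg; have := hY.last_nonneg
    simp only [Pi.add_apply]; linarith
  last_le i := by
    have := hX.last_le i; have := hY.last_le i
    simp only [Pi.add_apply]; linarith
  le_last := by
    have := hX.le_last; have := hY.le_last
    simp only [Pi.add_apply, Finset.sum_add_distrib]; linarith

theorem smul {X : Fin (n + 1) → R} {K c : R} (hX : PrismCone X K) (hc : 0 ≤ c) :
    PrismCone (c • X) (c * K) where
  base_nonneg i := mul_nonneg hc (hX.base_nonneg i)
  sum_le i := by
    have := mul_le_mul_of_nonneg_left (hX.sum_le i) hc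
    simp only [Pi.smul_apply, smul_eq_mul, ← Finset.mul_sum]; linarith
  last_nonneg := mul_nonneg hc hX.last_nonneg
  last_le i := by
    have := mul_le_mul_of_nonneg_left (hX.last_le i) hc
    simp only [Pi.smul_apply, smul_eq_mul]; linarith
  le_last := by
    have := mul_le_mul_of_nonneg_left hX.le_last hc
    simp only [Pi.smul_apply, smul_eq_mul, ← Finset.mul_sum]; linarith

theorem zero {K : R} (hK : 0 ≤ K) : PrismCone (0 : Fin (n + 1) → R) K where
  base_nonneg i := by simp
  sum_le i := by simpa
  last_nonneg := by simp
  last_le i := by simpa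
  le_last := by
    have : 0 ≤ (n : R) ^ 2 * K := by positivity
    simp; linarith

/-- Sum `sum_le` over all `i`. This bounds each slice and makes the cone pointed. -/
theorem sum_le_mul {X : Fin (n + 1) → R} {K : R} (hX : PrismCone X K) :
    ∑ j : Fin n, X j.castSucc ≤ n * K := by
  have := Finset.sum_le_sum fun i (_ : i ∈ Finset.univ) => hX.sum_le i
  simp only [Finset.sum_const, Finset.card_univ, Fintype.card_fin, nsmul_eq_mul,
    Finset.sum_add_distrib, ← Finset.mul_sum] at this
  linarith

theorem base_le_mul {X : Fin (n + 1) → R} {K : R} (hX : PrismCone X K) (i : Fin n) :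
    X i.castSucc ≤ n * K :=
  (Finset.single_le_sum (f := fun j : Fin n => X j.castSucc)
    (fun j _ => hX.base_nonneg j) (Finset.mem_univ i)).trans hX.sum_le_mul

theorem degree_nonneg {X : Fin (n + 1) → R} {K : R} (hn : 0 < n) (hX : PrismCone X K) :
    0 ≤ K := by
  have h := (Finset.sum_nonneg fun i (_ : i ∈ Finset.univ) => hX.base_nonneg i).trans hX.sum_le_mul
  have : (0 : R) < n := by exact_mod_cast hn
  exact nonneg_of_mul_nonneg_right h this

theorem eq_zero {X : Fin (n + 1) → R} (hn : 0 < n) (hX : PrismCone X 0) : X = 0 := by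
  have h0 (i : Fin n) : X i.castSucc = 0 :=
    le_antisymm (by simpa using hX.base_le_mul i) (hX.base_nonneg i)
  have hl := hX.last_le ⟨0, hn⟩
  rw [h0] at hl
  ext i
  refine Fin.lastCases ?_ (fun i => h0 i) i
  exact le_antisymm (by simpa using hl) hX.last_nonneg

/-- The inequalities are monotone in each base coordinate once the sum is fixed, so a common lower
bound `m` suffices. -/
theorem of_forall_le {X : Fin (n + 1) → R} {K m : R} (hn : 0 < n)
    (hm : ∀ i : Fin n, m ≤ X i.castSucc)
    (h0 : 0 ≤ m) (hs : ∑ j : Fin n, X j.castSucc ≤ ((n : R) - 1) * m + K)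
    (hl : 0 ≤ X (Fin.last n)) (hu : X (Fin.last n) ≤ (n : R) ^ 2 * m + K)
    (hle : (n : R) ^ 2 * (∑ j : Fin n, X j.castSucc - K) ≤ ((n : R) - 1) * X (Fin.last n)) :
    PrismCone X K where
  base_nonneg i := h0.trans (hm i)
  sum_le i := by
    have h1 : (1 : R) ≤ n := by exact_mod_cast hn
    have := mul_le_mul_of_nonneg_left (hm i) (sub_nonneg.2 h1)
    linarith
  last_nonneg := hl
  last_le i := by
    have := mul_le_mul_of_nonneg_left (hm i) (sq_nonneg (n : R))
    linarith
  le_last := hle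

/-- The point `e_j` in degree one. -/
theorem single (hn : 0 < n) (j : Fin n) :
    PrismCone (Pi.single j.castSucc 1 : Fin (n + 1) → R) 1 := by
  have h (i : Fin n) : (Pi.single j.castSucc 1 : Fin (n + 1) → R) i.castSucc
      = if i = j then 1 else 0 := by
    simp [Pi.single_apply]
  have hl : (Pi.single j.castSucc 1 : Fin (n + 1) → R) (Fin.last n) = 0 := by
    simp
  refine of_forall_le (m := 0) hn (fun i => ?_) le_rfl ?_ hl.ge ?_ ?_
  · rw [h]; split_ifs <;> simp
  · simp [h]
  · simp
  · simp [h]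

/-- The point `(1, …, 1, y)`. -/
theorem ones (hn : 0 < n) {y K : R} (hK : 1 ≤ K) (hy : 0 ≤ y) (hu : y ≤ (n : R) ^ 2 + K)
    (hl : (n : R) ^ 2 * (n - K) ≤ (n - 1) * y) :
    PrismCone (Fin.snoc (α := fun _ => R) (fun _ : Fin n => (1 : R)) y) K := by
  refine of_forall_le (m := 1) hn (fun i => ?_) zero_le_one ?_ ?_ ?_ ?_ <;>
    simp only [Fin.snoc_castSucc, Fin.snoc_last, Finset.sum_const, Finset.card_univ,
      Fintype.card_fin, nsmul_eq_mul, mul_one]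
  · exact le_rfl
  · linarith
  · exact hy
  · exact hu
  · exact hl

end Ordered

/-! ### Splitting off a lattice point of degree one. -/

variable {n : ℕ}

/-- The fibre over a base point is an interval of length at least `K ≥ 1`, so a point that cannot
move up can move down. -/
theorem add_or_sub_single_last {X : Fin (n + 1) → ℤ} {K : ℤ} (hn : 0 < n) (hK : 1 ≤ K)
    (hX : PrismCone X K) :
    PrismCone (X + Pi.single (Fin.last n) 1) K ∨ PrismCone (X - Pi.single (Fin.last n) 1) K := by
  have hn' : (1 : ℤ) ≤ n := by exact_mod_cast hn
  by_cases h : ∀ i : Fin n, X (Fin.last n) + 1 ≤ (n : ℤ) ^ 2 * X i.castSucc + K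
  · left
    have := hX.last_nonneg; have := hX.le_last
    exact hX.add_single_last (by linarith) h (by linarith)
  · right
    push Not at h
    obtain ⟨i, hi⟩ := h
    have h0 := hX.base_nonneg i
    have hs := mul_le_mul_of_nonneg_left (hX.sum_le i) (sq_nonneg (n : ℤ))
    have hp : 0 ≤ (n : ℤ) ^ 2 * X i.castSucc := by positivity
    have hm := mul_nonneg (sub_nonneg.2 hn')
      (show 0 ≤ X (Fin.last n) - 1 - ((n : ℤ) ^ 2 * X i.castSucc) by linarith)
    rw [sub_eq_add_neg, ← Pi.single_neg]
    refine hX.add_single_last (by linarith) (fun i => ?_) ?_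
    · have := hX.last_le i; linarith
    · linarith

/-- Removing one of the degree one points `w`, `w + e_d` from `X`. -/
theorem exists_sub_mem {X w : Fin (n + 1) → ℤ} {K m : ℤ} (hn : 0 < n) (hw : PrismCone w 1)
    (hw' : PrismCone (w + Pi.single (Fin.last n) 1) 1) (hK : 0 ≤ K)
    (hm : ∀ i : Fin n, m ≤ (X - w) i.castSucc) (h0 : 0 ≤ m)
    (hs : ∑ j : Fin n, (X - w) j.castSucc ≤ ((n : ℤ) - 1) * m + K)
    (hl : 0 ≤ (X - w) (Fin.last n)) (hu : (X - w) (Fin.last n) ≤ (n : ℤ) ^ 2 * m + K + 1)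
    (hle : (n : ℤ) ^ 2 * (∑ j : Fin n, (X - w) j.castSucc - K)
      ≤ ((n : ℤ) - 1) * (X - w) (Fin.last n)) :
    ∃ v, PrismCone v 1 ∧ PrismCone (X - v) K := by
  by_cases h : (X - w) (Fin.last n) ≤ (n : ℤ) ^ 2 * m + K
  · exact ⟨w, hw, of_forall_le hn hm h0 hs hl h hle⟩
  -- The upper bound fails by exactly one, which the extra `e_d` in `w + e_d` absorbs.
  · refine ⟨_, hw', ?_⟩
    have hlast : (X - w) (Fin.last n) = (n : ℤ) ^ 2 * m + K + 1 := by lia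
    have hc (i : Fin n) : (X - (w + (Pi.single (Fin.last n) 1 : Fin (n + 1) → ℤ))) i.castSucc
        = (X - w) i.castSucc := by
      simp
    have hl' : (X - (w + (Pi.single (Fin.last n) 1 : Fin (n + 1) → ℤ))) (Fin.last n)
        = (n : ℤ) ^ 2 * m + K := by
      simp only [Pi.sub_apply, Pi.add_apply, Pi.single_eq_same] at hlast ⊢
      lia
    have hn' : (1 : ℤ) ≤ n := by exact_mod_cast hn
    refine of_forall_le (m := m) hn (fun i => ?_) h0 ?_ ?_ ?_ ?_ <;> simp only [hc, hl']
    · exact hm i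
    · exact hs
    · positivity
    · exact le_rfl
    · have h1 := mul_le_mul_of_nonneg_left hs (sq_nonneg (n : ℤ))
      have h2 := mul_nonneg (sub_nonneg.2 hn') hK
      linarith

theorem single_last (hn : 0 < n) :
    PrismCone (Pi.single (Fin.last n) 1 : Fin (n + 1) → ℤ) 1 := by
  have hn' : (1 : ℤ) ≤ n := by exact_mod_cast hn
  rw [← zero_add (Pi.single _ _)]
  refine (zero zero_le_one).add_single_last ?_ ?_ ?_
  · simp
  · simp
  · simp only [Pi.zero_apply, Finset.sum_const_zero]
    nlinarith

theorem single_add_single_last (hn : 0 < n) (j : Fin n) :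
    PrismCone (Pi.single j.castSucc 1 + Pi.single (Fin.last n) 1 : Fin (n + 1) → ℤ) 1 := by
  have hn' : (1 : ℤ) ≤ n := by exact_mod_cast hn
  refine (single hn j).add_single_last ?_ (fun i => ?_) ?_
  · simp
  · have : 0 ≤ (n : ℤ) ^ 2 * (Pi.single j.castSucc 1 : Fin (n + 1) → ℤ) i.castSucc :=
      mul_nonneg (sq_nonneg _) ((single hn j).base_nonneg i)
    simpa using this
  · simp [Pi.single_apply]
    exact hn

theorem ones_add_single_last (hn : 0 < n) :
    PrismCone (Fin.snoc (α := fun _ => ℤ) (fun _ : Fin n => (1 : ℤ)) ((n : ℤ) ^ 2)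
      + Pi.single (Fin.last n) 1) 1 := by
  have hn' : (1 : ℤ) ≤ n := by exact_mod_cast hn
  refine (ones hn le_rfl (sq_nonneg _) (by linarith) (by linarith)).add_single_last ?_ ?_ ?_
  · simp; positivity
  · simp
  · simp; nlinarith

/-- A point of positive degree splits off a point of degree one, unless its base is
`(1, …, 1)` and its degree is at most `n`. -/
theorem exists_sub_mem_or {X : Fin (n + 1) → ℤ} {K : ℤ} (hn : 2 ≤ n) (hK : 1 ≤ K)
    (hX : PrismCone X K) :
    (∃ v, PrismCone v 1 ∧ PrismCone (X - v) (K - 1)) ∨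
      ((∀ i : Fin n, X i.castSucc = 1) ∧ K ≤ n ∧ (K = n → X (Fin.last n) = n + 1)) := by
  have hn0 : 0 < n := by lia
  have hn' : (2 : ℤ) ≤ n := by exact_mod_cast hn
  have : Nonempty (Fin n) := ⟨⟨0, hn0⟩⟩
  obtain ⟨i₀, hi₀⟩ := Finite.exists_min fun i : Fin n => X i.castSucc
  have hnn := hX.base_nonneg i₀
  have hs := hX.sum_le i₀
  have hl := hX.last_nonneg
  have hu := hX.last_le i₀
  have hle := hX.le_last
  have hsingle (j : Fin n) :
      ∑ i : Fin n, (X - (Pi.single j.castSucc 1 : Fin (n + 1) → ℤ)) i.castSucc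
        = ∑ i : Fin n, X i.castSucc - 1 := by
    simp [Pi.single_apply, Finset.sum_sub_distrib]
  have hsingle_last (j : Fin n) :
      (X - (Pi.single j.castSucc 1 : Fin (n + 1) → ℤ)) (Fin.last n) = X (Fin.last n) := by
    simp
  generalize hm : X i₀.castSucc = m at *
  generalize hy : X (Fin.last n) = y at *
  -- A coordinate above the minimum can be lowered without changing `m`: remove `e_j`.
  by_cases hlt : ∃ j : Fin n, m < X j.castSucc
  · left
    obtain ⟨j, hj⟩ := hlt
    refine exists_sub_mem (m := m) hn0 (single hn0 j) (single_add_single_last hn0 j)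
      (by lia) (fun i => ?_) hnn ?_ ?_ ?_ ?_
    · have := hi₀ i
      by_cases hij : i = j
      · subst hij; simp; lia
      · simp [hij]; lia
    all_goals simp only [hsingle, hsingle_last]
    · linarith
    · exact hl
    · linarith
    · linarith
  have heq (i : Fin n) : X i.castSucc = m := le_antisymm (by push Not at hlt; exact hlt i) (hi₀ i)
  have hsum : ∑ i : Fin n, X i.castSucc = n * m := by simp [heq]
  rw [hsum] at hs hle hsingle
  rcases lt_or_ge 1 m with hm1 | hm1
  · left
    rcases le_or_gt ((n : ℤ) ^ 2) y with hbig | hsmall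
    · refine exists_sub_mem (m := m - 1) hn0 (ones hn0 le_rfl (sq_nonneg _) (by linarith)
        (by linarith)) (ones_add_single_last hn0) (by lia) (fun i => ?_) (by lia) ?_ ?_ ?_ ?_ <;>
        simp only [Pi.sub_apply, Fin.snoc_castSucc, Fin.snoc_last, heq, hy, Finset.sum_const,
          Finset.card_univ, Fintype.card_fin, nsmul_eq_mul] <;> nlinarith
    -- With `y < n ^ 2`, `le_last` gives `n m - K < n - 1`; this slack in the degree lets `e_{i₀}`
    -- go although the minimum drops.
    · have hK' : (n : ℤ) * (m - 1) + 1 < K := by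
        by_contra! h
        nlinarith
      refine exists_sub_mem (m := m - 1) hn0 (single hn0 i₀) (single_add_single_last hn0 i₀)
        (by lia) (fun i => ?_) (by lia) ?_ ?_ ?_ ?_
      · by_cases hij : i = i₀
        · subst hij; simp [heq]
        · simp [hij, heq]
      all_goals simp only [hsingle, hsingle_last]
      · nlinarith
      · exact hl
      · nlinarith
      · linarith
  obtain rfl | rfl : m = 0 ∨ m = 1 := by lia
  · left
    refine exists_sub_mem (m := 0) (w := 0) hn0 (zero zero_le_one)
      (by rw [zero_add]; exact single_last hn0) (by lia) (fun i => ?_) le_rfl ?_ ?_ ?_ ?_ <;>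
      simp only [Pi.sub_apply, Pi.zero_apply, heq, hy, sub_zero, Finset.sum_const_zero] <;>
      first | linarith | nlinarith
  by_cases hbig : (n : ℤ) ^ 2 ≤ y
  · left
    refine exists_sub_mem (m := 0) hn0 (ones hn0 le_rfl (sq_nonneg _) (by linarith)
      (by linarith)) (ones_add_single_last hn0) (by lia) (fun i => ?_) (by lia) ?_ ?_ ?_ ?_ <;>
      simp only [Pi.sub_apply, Fin.snoc_castSucc, Fin.snoc_last, heq, hy, Finset.sum_const,
        Finset.card_univ, Fintype.card_fin, nsmul_eq_mul] <;> nlinarith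
  -- Here the base is `(1, …, 1)`. Removing `0` or `e_d` costs only degree; for `K = n` it needs `n
  -- ^ 2 ≤ (n - 1) y`, which holds from `y = n + 2` on.
  by_cases hzero : (n : ℤ) < K ∨ K = n ∧ (n : ℤ) + 2 ≤ y
  · left
    refine exists_sub_mem (m := 1) (w := 0) hn0 (zero zero_le_one)
      (by rw [zero_add]; exact single_last hn0) (by lia) (fun i => ?_) zero_le_one ?_ ?_ ?_ ?_ <;>
      simp only [Pi.sub_apply, Pi.zero_apply, heq, hy, sub_zero, Finset.sum_const,
        Finset.card_univ, Fintype.card_fin, nsmul_eq_mul]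
    · exact le_rfl
    · rcases hzero with h | ⟨h, -⟩ <;> lia
    · exact hl
    · linarith
    · rcases hzero with h | ⟨h, h2⟩ <;> nlinarith
  by_cases hsm : K = n ∧ y ≤ n
  · left
    refine exists_sub_mem (m := 0) hn0 (single hn0 i₀) (single_add_single_last hn0 i₀)
        (by lia) (fun i => ?_) le_rfl ?_ ?_ ?_ ?_
    · by_cases hij : i = i₀
      · subst hij; simp [heq]
      · simp [hij, heq]
    all_goals simp only [hsingle, hsingle_last]
    · lia
    · exact hl
    · lia
    · obtain ⟨rfl, h⟩ := hsm
      nlinarith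
  exact Or.inr ⟨heq, by lia, by lia⟩

end PrismCone

/-! ### Decompositions into larger degrees, and their obstructions. -/

namespace PrismCone

variable {n : ℕ}

theorem exists_sub_mem_or_eq {X : Fin (n + 1) → ℤ} {K : ℤ} (hn : 3 ≤ n) (hK : (n : ℤ) ≤ K)
    (hX : PrismCone X K) :
    (∃ Y, PrismCone Y ((n : ℤ) - 1) ∧ PrismCone (X - Y) (K - (n - 1))) ∨
      (K = n ∧ (∀ i : Fin n, X i.castSucc = 1) ∧ X (Fin.last n) = n + 1) := by
  have hn0 : 0 < n := by lia
  have hn' : (3 : ℤ) ≤ n := by exact_mod_cast hn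
  induction K, hK using Int.leInduction generalizing X with
  | base =>
    rcases exists_sub_mem_or (by lia) (by lia) hX with ⟨v, hv, hv'⟩ | ⟨h1, -, h2⟩
    · exact Or.inl ⟨X - v, hv', by simpa using hv⟩
    · exact Or.inr ⟨rfl, h1, h2 rfl⟩
  | succ K hK ih =>
    left
    rcases exists_sub_mem_or (by lia) (by lia) hX with ⟨v, hv, hv'⟩ | ⟨-, h2, -⟩
    swap
    · lia
    rw [add_sub_cancel_right] at hv'
    rcases ih hv' with ⟨Y, hY, hY'⟩ | ⟨rfl, hbase, hlast⟩
    · refine ⟨Y, hY, ?_⟩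
      have := hY'.add hv
      rwa [sub_right_comm, sub_add_cancel, show K - (n - 1) + 1 = K + 1 - ((n : ℤ) - 1) by ring]
        at this
    have hdeg : (n : ℤ) + 1 - (n - 1) = 1 + 1 := by ring
    rw [hdeg]
    -- The remainder is the exceptional point of degree `n`. Trading `e_d` with `v` moves its last
    -- coordinate to `n` or `n + 2`, where it is no longer exceptional.
    rcases add_or_sub_single_last hn0 le_rfl hv with h | h
    · have i₀ : Fin n := ⟨0, hn0⟩
      refine ⟨X - v - Pi.single (Fin.last n) 1
        - (Pi.single i₀.castSucc 1 + Pi.single (Fin.last n) 1), ?_, ?_⟩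
      · have hb (i : Fin n) : (X - v - Pi.single (Fin.last n) 1
            - (Pi.single i₀.castSucc 1 + Pi.single (Fin.last n) 1) : Fin (n + 1) → ℤ) i.castSucc
            = 1 - if i = i₀ then 1 else 0 := by
          rw [← hbase i]
          simp [Pi.single_apply]
        have hl : (X - v - Pi.single (Fin.last n) 1
            - (Pi.single i₀.castSucc 1 + Pi.single (Fin.last n) 1) : Fin (n + 1) → ℤ) (Fin.last n)
            = n - 1 := by
          rw [show (n : ℤ) - 1 = (X - v) (Fin.last n) - 2 by rw [hlast]; ring]
          simp
          ring
        refine of_forall_le (m := 0) hn0 (fun i => ?_) le_rfl ?_ ?_ ?_ ?_ <;>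
          simp only [hb, hl, Finset.sum_sub_distrib, Finset.sum_ite_eq', Finset.mem_univ, if_true,
            Finset.sum_const, Finset.card_univ, Fintype.card_fin, nsmul_eq_mul]
        · split_ifs <;> simp
        · lia
        · lia
        · lia
        · nlinarith
      · convert h.add (single_add_single_last hn0 i₀) using 1
        abel
    -- With last coordinate `n + 2` the remainder already lies in degree `n - 1`; the spare degree
    -- is filled by the point `0`.
    · refine ⟨X - (v - Pi.single (Fin.last n) 1), ?_, ?_⟩
      · have hb (i : Fin n) : (X - (v - Pi.single (Fin.last n) 1) : Fin (n + 1) → ℤ) i.castSucc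
            = 1 := by
          rw [← hbase i]
          simp
        have hl : (X - (v - Pi.single (Fin.last n) 1) : Fin (n + 1) → ℤ) (Fin.last n)
            = n + 2 := by
          rw [show (n : ℤ) + 2 = (X - v) (Fin.last n) + 1 by rw [hlast]; ring]
          simp
          ring
        refine of_forall_le (m := 1) hn0 (fun i => ?_) zero_le_one ?_ ?_ ?_ ?_ <;>
          simp only [hb, hl, Finset.sum_const, Finset.card_univ, Fintype.card_fin, nsmul_eq_mul]
        · exact le_rfl
        · lia
        · lia
        · nlinarith
        · nlinarith
      · convert h.add (zero zero_le_one) using 1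
        abel

theorem exists_add_of_le {k l : ℕ} (hn : 3 ≤ n) (hk : n - 1 ≤ k) (hl : n - 1 ≤ l)
    {X : Fin (n + 1) → ℤ} (hX : PrismCone X ((k : ℤ) + l)) :
    ∃ Y, PrismCone Y (k : ℤ) ∧ PrismCone (X - Y) (l : ℤ) := by
  induction k, hk using Nat.le_induction generalizing X with
  | base =>
    rw [Nat.cast_sub (by lia), Nat.cast_one] at hX ⊢
    rcases exists_sub_mem_or_eq hn (by lia) hX with ⟨Y, hY, hY'⟩ | ⟨h, -, -⟩
    · exact ⟨Y, hY, by simpa using hY'⟩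
    · lia
  | succ k hk ih =>
    rcases exists_sub_mem_or (by lia) (by lia) hX with ⟨v, hv, hv'⟩ | ⟨-, h2, -⟩
    · rw [Nat.cast_succ, show (k : ℤ) + 1 + l - 1 = k + l by ring] at hv'
      obtain ⟨Y, hY, hY'⟩ := ih hv'
      refine ⟨Y + v, by exact_mod_cast hY.add hv, ?_⟩
      rwa [sub_add_eq_sub_sub, sub_right_comm]
    · lia

theorem exists_eq_sum {j k : ℕ} (hn : 3 ≤ n) (hk : n - 1 ≤ k) (hj : 1 ≤ j)
    {X : Fin (n + 1) → ℤ} (hX : PrismCone X ((j : ℤ) * k)) :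
    ∃ β : Fin j → Fin (n + 1) → ℤ, (∀ i, PrismCone (β i) (k : ℤ)) ∧ X = ∑ i, β i := by
  induction j, hj using Nat.le_induction generalizing X with
  | base => exact ⟨fun _ => X, fun _ => by simpa using hX, by simp⟩
  | succ j hj ih =>
    obtain ⟨Y, hY, hY'⟩ := exists_add_of_le (k := k) (l := j * k) (X := X) hn hk
      (hk.trans (Nat.le_mul_of_pos_left k hj)) (by push_cast at hX ⊢; rwa [add_comm, ← add_one_mul])
    obtain ⟨β, hβ, hsum⟩ := ih (by exact_mod_cast hY')
    refine ⟨Fin.cons Y β, Fin.cases hY hβ, ?_⟩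
    simp [Fin.sum_univ_succ, ← hsum]

/-- Integrality enters here: base coordinates that are all nonzero are at least `1`, so their sum is
at least `n` in `le_last`. -/
theorem last_le_or_le_last {X : Fin (n + 1) → ℤ} {K : ℤ} (hX : PrismCone X K) :
    X (Fin.last n) ≤ K ∨ (n : ℤ) ^ 2 * (n - K) ≤ (n - 1) * X (Fin.last n) := by
  by_cases h : ∃ i : Fin n, X i.castSucc = 0
  · obtain ⟨i, hi⟩ := h
    left
    simpa [hi] using hX.last_le i
  · right
    push Not at h
    have hs : (n : ℤ) ≤ ∑ i : Fin n, X i.castSucc := by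
      have := Finset.sum_le_sum fun i (_ : i ∈ Finset.univ) =>
        Int.add_one_le_of_lt (lt_of_le_of_ne (hX.base_nonneg i) (h i).symm)
      simpa using this
    have := mul_le_mul_of_nonneg_left hs (sq_nonneg (n : ℤ))
    linarith [hX.le_last]

theorem exists_forall_ne_sum {k : ℕ} (hk : 1 ≤ k) (hkn : k + 2 ≤ n) :
    ∃ j : ℕ, 1 ≤ j ∧ ∃ X : Fin (n + 1) → ℤ, PrismCone X ((j : ℤ) * k) ∧
      ∀ β : Fin j → Fin (n + 1) → ℤ, (∀ i, PrismCone (β i) (k : ℤ)) → X ≠ ∑ i, β i := by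
  obtain ⟨j, hj, h1, h2⟩ : ∃ j : ℕ, 1 ≤ j ∧ n ≤ j * k ∧ j * k ≤ n + k := by
    -- The degree `j k` must reach `n` for `(1, …, 1, j k + 1)` to lie in the cone, yet stay at most
    -- `n + k` so that no summand can afford `y ≥ n ^ 2 (n - k) / (n - 1)`.
    refine ⟨n / k + 1, by lia, ?_, ?_⟩
    · have := Nat.lt_div_mul_add (a := n) hk
      lia
    · have := Nat.div_mul_le_self n k
      lia
  zify at hj h1 h2 hk hkn
  refine ⟨j, by exact_mod_cast hj,
    Fin.snoc (α := fun _ => ℤ) (fun _ : Fin n => (1 : ℤ)) (j * k + 1),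
    ones (by lia) (by lia) (by lia) (by nlinarith) (by nlinarith), fun β hβ h => ?_⟩
  have hlast := congrFun h (Fin.last n)
  rw [Fin.snoc_last, Finset.sum_apply] at hlast
  by_cases hall : ∀ i, β i (Fin.last n) ≤ k
  · have := Finset.sum_le_sum fun i (_ : i ∈ Finset.univ) => hall i
    simp at this
    lia
  · push Not at hall
    obtain ⟨i, hi⟩ := hall
    have hle := (hβ i).last_le_or_le_last.resolve_left hi.not_ge
    have := Finset.single_le_sum (f := fun i => β i (Fin.last n)) (fun i _ => (hβ i).last_nonneg)
      (Finset.mem_univ i)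
    nlinarith

theorem ones_irreducible (hn : 2 ≤ n) {A B : Fin (n + 1) → ℤ} {a b : ℤ} (hA : PrismCone A a)
    (hB : PrismCone B b) (hab : a + b = n)
    (h : A (Fin.last n) + B (Fin.last n) = n + 1) : a = 0 ∨ b = 0 := by
  have hn' : (2 : ℤ) ≤ n := by exact_mod_cast hn
  have hA0 := hA.degree_nonneg (by lia)
  have hB0 := hB.degree_nonneg (by lia)
  have hA1 := hA.last_nonneg
  have hB1 := hB.last_nonneg
  by_contra! hne
  rcases hA.last_le_or_le_last with hA2 | hA2
  · rcases hB.last_le_or_le_last with hB2 | hB2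
    · lia
    · have : 1 ≤ n - b := by lia
      nlinarith
  · have : 1 ≤ n - a := by lia
    nlinarith

end PrismCone

/-! ### The polytope and its cone in coordinates. -/

theorem liftedPolytope_eq_prod {N : ℕ} (P : Set (Fin N → ℝ)) :
    liftedPolytope P = P ×ˢ ({1} : Set ℝ) := by
  ext ⟨x, t⟩
  simp [liftedPolytope, eq_comm]

/-- Krein–Milman; with finitely many extreme points their convex hull is already closed. -/
theorem liftedPolytope_subset_polytopeCone {N : ℕ} {A : Set (Fin N → ℝ)} (hA : A.Finite) :
    liftedPolytope (convexHull ℝ A) ⊆ polytopeCone (convexHull ℝ A) := by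
  have hfin : ((liftedPolytope (convexHull ℝ A)).extremePoints ℝ).Finite := by
    rw [liftedPolytope_eq_prod, extremePoints_prod, extremePoints_singleton]
    exact (hA.subset extremePoints_convexHull_subset).prod (Set.finite_singleton _)
  have hcompact : IsCompact (liftedPolytope (convexHull ℝ A)) := by
    rw [liftedPolytope_eq_prod]
    exact (hA.isCompact_convexHull ℝ).prod isCompact_singleton
  have hconvex : Convex ℝ (liftedPolytope (convexHull ℝ A)) := by
    rw [liftedPolytope_eq_prod]
    exact (convex_convexHull ℝ A).prod (convex_singleton 1)
  have h := closure_convexHull_extremePoints hcompact hconvex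
  rw [(hfin.isClosed_convexHull ℝ).closure_eq] at h
  calc liftedPolytope (convexHull ℝ A) = _ := h.symm
    _ ⊆ _ := convexHull_min PointedCone.subset_hull (PointedCone.convex _)

/-- The vertices of `prismPolytope d`. -/
def prismVertices (d : ℕ) : Finset (Fin d → ℤ) :=
  (Finset.range (d + 1)).image (prismPoint d) ∪
    (Finset.range (d + 1)).image fun j => prismPoint d j + unitVec d d

theorem prismPolytope_eq (d : ℕ) :
    prismPolytope d = convexHull ℝ (toRealVec '' (prismVertices d : Set (Fin d → ℤ))) := by
  unfold prismPolytope
  congr 1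
  ext x
  simp only [Set.mem_ofPred_eq, Set.mem_image, Finset.mem_coe, prismVertices, Finset.mem_union,
    Finset.mem_image, Finset.mem_range, Nat.lt_succ_iff]
  constructor
  · rintro ⟨j, hj, rfl | rfl⟩
    · exact ⟨_, Or.inl ⟨j, hj, rfl⟩, rfl⟩
    · exact ⟨_, Or.inr ⟨j, hj, rfl⟩, rfl⟩
  · rintro ⟨_, ⟨j, hj, rfl⟩ | ⟨j, hj, rfl⟩, rfl⟩
    · exact ⟨j, hj, Or.inl rfl⟩
    · exact ⟨j, hj, Or.inr rfl⟩

theorem isIntegralPolytope_prismPolytope (d : ℕ) : IsIntegralPolytope (prismPolytope d) :=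
  ⟨prismVertices d,
    ⟨prismPoint d 0, Finset.mem_union_left _ (Finset.mem_image_of_mem _ (by simp))⟩,
    prismPolytope_eq d⟩

theorem unitVec_succ {N : ℕ} (i : Fin N) : unitVec N (i + 1) = Pi.single i 1 := by
  ext k
  simp [unitVec, Pi.single_apply, Fin.ext_iff]

theorem toRealVec_add {N : ℕ} (α β : Fin N → ℤ) :
    toRealVec (α + β) = toRealVec α + toRealVec β := by
  ext; simp [toRealVec]

theorem toRealVec_single {N : ℕ} (i : Fin N) (c : ℤ) :
    toRealVec (Pi.single i c) = Pi.single i (c : ℝ) := by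
  ext k
  by_cases h : k = i
  · subst h; simp [toRealVec]
  · simp [toRealVec, h]

section

variable {n : ℕ}

theorem unitVec_last : unitVec (n + 1) (n + 1) = Pi.single (Fin.last n) 1 :=
  unitVec_succ (Fin.last n)

theorem prismPoint_castSucc_succ (i : Fin n) :
    prismPoint (n + 1) (i + 1) = Pi.single i.castSucc 1 := by
  rw [prismPoint, if_neg (by lia), if_pos (by lia)]
  exact unitVec_succ i.castSucc

theorem prismPoint_last :
    prismPoint (n + 1) (n + 1)
      = Fin.snoc (α := fun _ => ℤ) (fun _ : Fin n => (1 : ℤ)) ((n : ℤ) ^ 2) := by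
  rw [prismPoint, if_neg (by lia), if_neg (by lia), unitVec_last]
  ext k
  refine Fin.lastCases ?_ (fun i => ?_) k
  · have (j : ℕ) (hj : j ∈ Finset.Icc 1 n) : unitVec (n + 1) j (Fin.last n) = 0 := by
      rw [Finset.mem_Icc] at hj
      simp [unitVec]
      lia
    simp [Finset.sum_apply, Finset.sum_eq_zero this]
    ring
  · simp [Finset.sum_apply, unitVec]

theorem PrismCone.of_prismPoint (hn : 0 < n) {j : ℕ} (hj : j ≤ n + 1) :
    PrismCone (prismPoint (n + 1) j) (1 : ℤ) ∧
      PrismCone (prismPoint (n + 1) j + unitVec (n + 1) (n + 1)) (1 : ℤ) := by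
  rw [unitVec_last]
  obtain _ | i := j
  · rw [prismPoint, if_pos rfl, zero_add]
    exact ⟨zero zero_le_one, single_last hn⟩
  obtain hi | rfl : i < n ∨ i = n := by lia
  · have := prismPoint_castSucc_succ ⟨i, hi⟩
    simp only at this
    rw [this]
    exact ⟨single hn _, single_add_single_last hn _⟩
  · rw [prismPoint_last]
    exact ⟨ones hn le_rfl (sq_nonneg _) (by lia) (by lia), ones_add_single_last hn⟩

theorem prismCone_toRealVec {X : Fin (n + 1) → ℤ} {K : ℤ} :
    PrismCone (toRealVec X) (K : ℝ) ↔ PrismCone X K := by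
  constructor <;> rintro ⟨h1, h2, h3, h4, h5⟩ <;> constructor
  all_goals
    simp only [toRealVec] at *
    first
      | exact_mod_cast h1 | exact_mod_cast h2 | exact_mod_cast h3 | exact_mod_cast h4
      | exact_mod_cast h5

theorem PrismCone.of_mem_prismPolytope (hn : 0 < n) {X : Fin (n + 1) → ℝ}
    (hX : X ∈ prismPolytope (n + 1)) : PrismCone X (1 : ℝ) := by
  suffices prismPolytope (n + 1) ⊆ {X | PrismCone X (1 : ℝ)} from this hX
  refine convexHull_min ?_ ?_
  · rintro _ ⟨j, hj, rfl | rfl⟩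
    · exact_mod_cast prismCone_toRealVec.2 (of_prismPoint hn hj).1
    · exact_mod_cast prismCone_toRealVec.2 (of_prismPoint hn hj).2
  · intro X hX Y hY a b ha hb hab
    have := (hX.smul ha).add (hY.smul hb)
    rwa [mul_one, mul_one, hab] at this

theorem PrismCone.mem_prismPolytope (hn : 2 ≤ n) {X : Fin (n + 1) → ℝ}
    (hX : PrismCone X (1 : ℝ)) : X ∈ prismPolytope (n + 1) := by
  have hn0 : 0 < n := by lia
  have hn' : (2 : ℝ) ≤ n := by exact_mod_cast hn
  have hn1 : (0 : ℝ) < n - 1 := by linarith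
  have hM : (0 : ℝ) < (n : ℝ) ^ 2 := by positivity
  set S := ∑ j : Fin n, X j.castSucc with hS
  set y := X (Fin.last n) with hy
  have hl := hX.last_nonneg
  obtain ⟨t, ht0, htS, hty, htx, hty'⟩ : ∃ t : ℝ, 0 ≤ t ∧ S - 1 ≤ (n - 1) * t ∧
      y - 1 ≤ (n : ℝ) ^ 2 * t ∧ (∀ i : Fin n, t ≤ X i.castSucc) ∧ (n : ℝ) ^ 2 * t ≤ y := by
    -- The weight `t` is the largest of its lower bounds; comparing each with each upper bound uses
    -- up the inequalities.
    refine ⟨max 0 (max ((S - 1) / (n - 1)) ((y - 1) / (n : ℝ) ^ 2)), le_max_left _ _, ?_, ?_,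
      fun i => ?_, ?_⟩
    · rw [← div_le_iff₀' hn1]
      exact (le_max_left _ _).trans (le_max_right _ _)
    · rw [← div_le_iff₀' hM]
      exact (le_max_right _ _).trans (le_max_right _ _)
    · refine max_le (hX.base_nonneg i) (max_le ?_ ?_)
      · rw [div_le_iff₀' hn1]; linarith [hX.sum_le i]
      · rw [div_le_iff₀' hM]; linarith [hX.last_le i]
    · rw [← le_div_iff₀' hM]
      refine max_le (by positivity) (max_le ?_ ?_)
      · rw [div_le_div_iff₀ hn1 hM]; linarith [hX.le_last]
      · gcongr; linarith
  have hconv : Convex ℝ (prismPolytope (n + 1)) := convex_convexHull ℝ _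
  have hv (j : ℕ) (hj : j ≤ n + 1) :
      toRealVec (prismPoint (n + 1) j) ∈ prismPolytope (n + 1) ∧
        toRealVec (prismPoint (n + 1) j) + Pi.single (Fin.last n) 1 ∈ prismPolytope (n + 1) := by
    constructor <;> refine subset_convexHull ℝ _ ⟨j, hj, ?_⟩
    · exact Or.inl rfl
    · rw [toRealVec_add, unitVec_last, toRealVec_single, Int.cast_one]
      exact Or.inr rfl
  set w : Fin (n + 2) → ℝ := Fin.cons (1 - S + (n - 1) * t)
    (Fin.snoc (α := fun _ => ℝ) (fun i : Fin n => X i.castSucc - t) t) with hw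
  have hw0 (j : Fin (n + 2)) : 0 ≤ w j := by
    refine Fin.cases ?_ (Fin.lastCases ?_ fun i => ?_) j
    · simp only [hw, Fin.cons_zero]; linarith
    · simpa only [hw, Fin.cons_succ, Fin.snoc_last] using ht0
    · simp only [hw, Fin.cons_succ, Fin.snoc_castSucc]; linarith [htx i]
  have hw1 : ∑ j, w j = 1 := by
    simp only [hw, Fin.sum_univ_succ, Fin.cons_zero, Fin.cons_succ]
    rw [← Fin.sum_univ_succ (f := Fin.snoc (α := fun _ => ℝ) (fun i : Fin n => X i.castSucc - t) t),
      Fin.sum_univ_castSucc]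
    simp only [Fin.snoc_castSucc, Fin.snoc_last, Finset.sum_sub_distrib, Finset.sum_const,
      Finset.card_univ, Fintype.card_fin, nsmul_eq_mul, ← hS]
    ring
  have hsum : ∑ j : Fin (n + 2), w j • toRealVec (prismPoint (n + 1) j)
      = X - (y - (n : ℝ) ^ 2 * t) • Pi.single (Fin.last n) 1 := by
    rw [Fin.sum_univ_succ, Fin.sum_univ_castSucc]
    simp only [hw, Fin.cons_zero, Fin.cons_succ, Fin.snoc_castSucc, Fin.snoc_last, Fin.val_zero,
      Fin.val_succ, Fin.val_castSucc, Fin.val_last, prismPoint_castSucc_succ, prismPoint_last,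
      toRealVec_single]
    ext k
    refine Fin.lastCases ?_ (fun i => ?_) k
    · simp [Finset.sum_apply, prismPoint, toRealVec]
      ring
    · simp [Finset.sum_apply, prismPoint, toRealVec, Pi.single_apply]
  -- `X` lies on the vertical unit segment between these two points, at height `y - n ^ 2 t`.
  have h0 := hconv.sum_mem (fun j _ => hw0 j) hw1 fun j _ => (hv j (by lia)).1
  have h1 := hconv.sum_mem (fun j _ => hw0 j) hw1 fun j _ => (hv j (by lia)).2
  simp only [smul_add, Finset.sum_add_distrib, ← Finset.sum_smul, hw1, one_smul] at h1
  rw [hsum] at h0 h1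
  have := hconv h0 h1 (a := 1 - (y - (n : ℝ) ^ 2 * t)) (b := y - (n : ℝ) ^ 2 * t)
    (by linarith) (by linarith) (by ring)
  convert this using 1
  module

theorem mem_prismPolytope_iff (hn : 2 ≤ n) {X : Fin (n + 1) → ℝ} :
    X ∈ prismPolytope (n + 1) ↔ PrismCone X (1 : ℝ) :=
  ⟨PrismCone.of_mem_prismPolytope (by lia), PrismCone.mem_prismPolytope hn⟩

theorem mem_smul_prismPolytope_iff (hn : 2 ≤ n) {X : Fin (n + 1) → ℝ} {K : ℝ} (hK : 0 < K) :
    X ∈ K • prismPolytope (n + 1) ↔ PrismCone X K := by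
  rw [Set.mem_smul_set_iff_inv_smul_mem₀ hK.ne', mem_prismPolytope_iff hn]
  constructor <;> intro h
  · simpa [hK.ne'] using h.smul hK.le
  · simpa [hK.ne'] using h.smul (inv_nonneg.2 hK.le)

theorem mem_polytopeCone_prismPolytope_iff (hn : 2 ≤ n) {X : Fin (n + 1) → ℝ} {K : ℝ} :
    (X, K) ∈ polytopeCone (prismPolytope (n + 1)) ↔ PrismCone X K := by
  constructor
  · intro h
    suffices ∀ z ∈ polytopeCone (prismPolytope (n + 1)), PrismCone z.1 z.2 from this _ h
    intro z hz
    induction hz using Submodule.span_induction with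
    | mem z hz =>
      obtain ⟨x, hx, rfl⟩ := extremePoints_subset hz
      exact PrismCone.of_mem_prismPolytope (by lia) hx
    | zero => exact PrismCone.zero le_rfl
    | add _ _ _ _ h1 h2 => exact h1.add h2
    | smul c _ _ h => exact h.smul c.2
  · intro h
    rcases (h.degree_nonneg (by lia)).eq_or_lt with rfl | hK
    · rw [h.eq_zero (by lia)]
      exact zero_mem _
    · obtain ⟨x, hx, rfl⟩ := (mem_smul_prismPolytope_iff hn hK).2 h
      have hmem : (x, (1 : ℝ)) ∈ polytopeCone (prismPolytope (n + 1)) := by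
        rw [prismPolytope_eq] at hx ⊢
        exact liftedPolytope_subset_polytopeCone ((Finset.finite_toSet _).image _) ⟨x, hx, rfl⟩
      simpa using PointedCone.smul_mem _ hK.le hmem

theorem mem_coneIntegerPoints_prismPolytope_iff (hn : 2 ≤ n) {z : (Fin (n + 1) → ℤ) × ℤ} :
    z ∈ coneIntegerPoints (polytopeCone (prismPolytope (n + 1))) ↔ PrismCone z.1 z.2 := by
  rw [← prismCone_toRealVec, ← mem_polytopeCone_prismPolytope_iff hn]
  rfl

theorem polytopeDim_prismPolytope (hn : 2 ≤ n) :
    polytopeDim (prismPolytope (n + 1)) = n + 1 := by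
  have h0 : (0 : Fin (n + 1) → ℝ) ∈ prismPolytope (n + 1) :=
    (PrismCone.zero zero_le_one).mem_prismPolytope hn
  have hmem (i : Fin (n + 1)) : (Pi.single i 1 : Fin (n + 1) → ℝ) ∈ prismPolytope (n + 1) := by
    refine PrismCone.mem_prismPolytope hn ?_
    refine Fin.lastCases ?_ (fun i => PrismCone.single (by lia) i) i
    have := prismCone_toRealVec.2 (PrismCone.single_last (n := n) (by lia))
    rwa [toRealVec_single, Int.cast_one] at this
  have htop : vectorSpan ℝ (prismPolytope (n + 1)) = ⊤ := by
    rw [eq_top_iff, ← (Pi.basisFun ℝ (Fin (n + 1))).span_eq, Submodule.span_le]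
    rintro _ ⟨i, rfl⟩
    rw [Pi.basisFun_apply]
    simpa using vsub_mem_vectorSpan ℝ (hmem i) h0
  rw [polytopeDim, htop, finrank_top, Module.finrank_fin_fun]

theorem hasIDP_smul_prismPolytope_iff (hn : 3 ≤ n) {k : ℕ} (hk : 1 ≤ k) :
    HasIDP ((k : ℝ) • prismPolytope (n + 1)) ↔ n - 1 ≤ k := by
  have hk' : (0 : ℝ) < k := by exact_mod_cast hk
  have hmem (X : Fin (n + 1) → ℤ) :
      toRealVec X ∈ (k : ℝ) • prismPolytope (n + 1) ↔ PrismCone X (k : ℤ) := by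
    rw [mem_smul_prismPolytope_iff (by lia) hk', ← prismCone_toRealVec, Int.cast_natCast]
  have hmem_mul {j : ℕ} (hj : 1 ≤ j) (X : Fin (n + 1) → ℤ) :
      toRealVec X ∈ (j : ℝ) • (k : ℝ) • prismPolytope (n + 1) ↔ PrismCone X ((j : ℤ) * k) := by
    have hj' : (0 : ℝ) < j := by exact_mod_cast hj
    rw [smul_smul, mem_smul_prismPolytope_iff (by lia) (mul_pos hj' hk'), ← prismCone_toRealVec,
      Int.cast_mul, Int.cast_natCast, Int.cast_natCast]
  constructor
  · intro h
    by_contra! hlt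
    obtain ⟨j, hj, X, hX, hne⟩ := PrismCone.exists_forall_ne_sum (n := n) hk (by lia)
    obtain ⟨β, hβ, hsum⟩ := h j hj X ((hmem_mul hj X).2 hX)
    exact hne β (fun i => (hmem _).1 (hβ i)) hsum
  · intro h j hj X hX
    obtain ⟨β, hβ, hsum⟩ := PrismCone.exists_eq_sum hn h hj ((hmem_mul hj X).1 hX)
    exact ⟨β, fun i => (hmem _).2 (hβ i), hsum⟩

end

/-! ### Irreducible points and the minimal Hilbert basis. -/

section

variable {n : ℕ}

/-- The irreducible integer points of the cone over `prismPolytope (n + 1)`. -/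
def PrismIrreducible (n : ℕ) (z : (Fin (n + 1) → ℤ) × ℤ) : Prop :=
  z ≠ 0 ∧ PrismCone z.1 z.2 ∧ ∀ a b : (Fin (n + 1) → ℤ) × ℤ,
    PrismCone a.1 a.2 → PrismCone b.1 b.2 → z = a + b → a = 0 ∨ b = 0

theorem PrismCone.prod_eq_zero (hn : 0 < n) {z : (Fin (n + 1) → ℤ) × ℤ}
    (hz : PrismCone z.1 z.2) (h : z.2 = 0) : z = 0 := by
  rw [h] at hz
  exact Prod.ext (hz.eq_zero hn) h

theorem PrismIrreducible.degree_le (hn : 2 ≤ n) {z : (Fin (n + 1) → ℤ) × ℤ}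
    (hz : PrismIrreducible n z) : z.2 ≤ n := by
  obtain ⟨-, hz, hirr⟩ := hz
  by_contra! hlt
  rcases PrismCone.exists_sub_mem_or hn (by lia) hz with ⟨v, hv, hv'⟩ | ⟨-, h, -⟩
  · rcases hirr (v, 1) (z.1 - v, z.2 - 1) hv hv' (by ext <;> simp) with h | h
    · simpa using congrArg Prod.snd h
    · have := congrArg Prod.snd h
      simp only [Prod.snd_zero] at this
      lia
  · lia

theorem finite_prismIrreducible (hn : 2 ≤ n) :
    {z : (Fin (n + 1) → ℤ) × ℤ | PrismIrreducible n z}.Finite := by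
  refine ((Set.finite_Icc (0 : Fin (n + 1) → ℤ) fun _ => (n : ℤ) ^ 2 * (n * n) + n).prod
    (Set.finite_Icc (0 : ℤ) n)).subset fun z hz => ?_
  have hn' : (1 : ℤ) ≤ n := by exact_mod_cast (by lia : 1 ≤ n)
  have hdeg := hz.degree_le hn
  obtain ⟨-, hz, -⟩ := hz
  have hbase (i : Fin n) : z.1 i.castSucc ≤ n * n :=
    (hz.base_le_mul i).trans (by gcongr)
  have hsq : (1 : ℤ) ≤ (n : ℤ) ^ 2 := one_le_pow₀ hn'
  have hlast := hz.last_le ⟨0, by lia⟩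
  have h0 := mul_le_mul_of_nonneg_left (hbase ⟨0, by lia⟩) (sq_nonneg (n : ℤ))
  refine ⟨⟨fun i => ?_, fun i => ?_⟩, hz.degree_nonneg (by lia), hdeg⟩ <;>
    refine Fin.lastCases ?_ (fun i => ?_) i
  · exact hz.last_nonneg
  · exact hz.base_nonneg i
  · show z.1 (Fin.last n) ≤ (n : ℤ) ^ 2 * (n * n) + n
    linarith
  · show z.1 i.castSucc ≤ (n : ℤ) ^ 2 * (n * n) + n
    nlinarith [hbase i]

/-- Only zero has degree `0`, so both parts of a nontrivial splitting have smaller degree. -/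
theorem PrismCone.mem_closure_irreducible (hn : 2 ≤ n) {z : (Fin (n + 1) → ℤ) × ℤ}
    (hz : PrismCone z.1 z.2) : z ∈ AddSubmonoid.closure {z | PrismIrreducible n z} := by
  induction hm : z.2.toNat using Nat.strong_induction_on generalizing z with
  | _ m ih =>
    by_cases h0 : z = 0
    · rw [h0]
      exact zero_mem _
    by_cases hirr : PrismIrreducible n z
    · exact AddSubmonoid.subset_closure hirr
    simp only [PrismIrreducible, not_and, not_forall, not_or] at hirr
    obtain ⟨a, b, ha, hb, rfl, ha0, hb0⟩ := hirr h0 hz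
    have ha1 := ha.degree_nonneg (by lia)
    have hb1 := hb.degree_nonneg (by lia)
    have ha2 : a.2 ≠ 0 := fun h => ha0 (ha.prod_eq_zero (by lia) h)
    have hb2 : b.2 ≠ 0 := fun h => hb0 (hb.prod_eq_zero (by lia) h)
    rw [Prod.snd_add] at hm
    exact add_mem (ih _ (by lia) ha rfl) (ih _ (by lia) hb rfl)

theorem PrismIrreducible.mem_of_mem_closure {z : (Fin (n + 1) → ℤ) × ℤ}
    (hz : PrismIrreducible n z) {s : Set ((Fin (n + 1) → ℤ) × ℤ)}
    (hs : ∀ w ∈ AddSubmonoid.closure s, PrismCone w.1 w.2) (h : z ∈ AddSubmonoid.closure s) :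
    z ∈ s := by
  induction h using AddSubmonoid.closure_induction with
  | mem w hw => exact hw
  | zero => exact absurd rfl hz.1
  | add a b ha hb iha ihb =>
    rcases hz.2.2 a b (hs a ha) (hs b hb) rfl with rfl | rfl
    · rw [zero_add] at hz ⊢
      exact ihb hz
    · rw [add_zero] at hz ⊢
      exact iha hz

theorem prismIrreducible_ones (hn : 2 ≤ n) :
    PrismIrreducible n
      (Fin.snoc (α := fun _ => ℤ) (fun _ : Fin n => (1 : ℤ)) ((n : ℤ) + 1), (n : ℤ)) := by
  have hn' : (2 : ℤ) ≤ n := by exact_mod_cast hn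
  refine ⟨fun h => ?_, PrismCone.ones (by lia) (by lia) (by lia) (by nlinarith) (by nlinarith),
    fun a b ha hb hab => ?_⟩
  · have : (n : ℤ) = 0 := congrArg Prod.snd h
    lia
  · have hdeg : (n : ℤ) = a.2 + b.2 := congrArg Prod.snd hab
    have hlast := congrFun (congrArg Prod.fst hab) (Fin.last n)
    simp only [Fin.snoc_last, Prod.fst_add, Pi.add_apply] at hlast
    exact (PrismCone.ones_irreducible hn ha hb hdeg.symm hlast.symm).imp
      (ha.prod_eq_zero (by lia)) (hb.prod_eq_zero (by lia))

theorem isMuHilb_prismPolytope (hn : 2 ≤ n) : IsMuHilb (prismPolytope (n + 1)) n := by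
  have hset (H : Finset ((Fin (n + 1) → ℤ) × ℤ)) :
      IsHilbertBasis (polytopeCone (prismPolytope (n + 1))) H ↔
        ∀ z : (Fin (n + 1) → ℤ) × ℤ, PrismCone z.1 z.2 ↔
          z ∈ AddSubmonoid.closure (H : Set ((Fin (n + 1) → ℤ) × ℤ)) := by
    simp only [IsHilbertBasis, Set.ext_iff, mem_coneIntegerPoints_prismPolytope_iff hn,
      SetLike.mem_coe]
  refine ⟨(finite_prismIrreducible hn).toFinset, ⟨(hset _).2 fun z => ?_, fun H hH z hz => ?_⟩,
    ⟨(Fin.snoc (α := fun _ => ℤ) (fun _ : Fin n => (1 : ℤ)) ((n : ℤ) + 1), (n : ℤ)), ?_, rfl⟩, ?_⟩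
  · rw [Set.Finite.coe_toFinset]
    refine ⟨PrismCone.mem_closure_irreducible hn, fun h => ?_⟩
    induction h using AddSubmonoid.closure_induction with
    | mem w hw => exact hw.2.1
    | zero => exact PrismCone.zero le_rfl
    | add a b _ _ ha hb => exact ha.add hb
  · have hz' : PrismIrreducible n z := by simpa using hz
    have hH' := (hset H).1 hH
    exact hz'.mem_of_mem_closure (fun w => (hH' w).2) ((hH' z).1 hz'.2.1)
  · exact (finite_prismIrreducible hn).mem_toFinset.2 (prismIrreducible_ones hn)
  · rintro _ ⟨z, hz, rfl⟩
    exact ((finite_prismIrreducible hn).mem_toFinset.1 hz).degree_le hn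

end

theorem theorem2p3 (d : ℕ) (hd : 4 ≤ d) :
    ∃ P : Set (Fin d → ℝ), P = prismPolytope d ∧
      IsIntegralPolytope P ∧ polytopeDim P = d ∧
      IsMuHilb P (d - 1) ∧ IsMuMidp P (d - 2) ∧ IsMuIdp P (d - 2) := by
  obtain ⟨n, rfl⟩ : ∃ n, d = n + 1 := ⟨d - 1, by lia⟩
  have hn : 3 ≤ n := by lia
  refine ⟨_, rfl, isIntegralPolytope_prismPolytope _, polytopeDim_prismPolytope (by lia),
    isMuHilb_prismPolytope (by lia), ⟨⟨by lia, ?_⟩, ?_⟩, ⟨⟨by lia, ?_⟩, ?_⟩⟩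
  · exact (hasIDP_smul_prismPolytope_iff hn (by lia)).2 (by lia)
  · rintro k ⟨hk, h⟩
    exact (hasIDP_smul_prismPolytope_iff hn hk).1 h
  · exact fun k hk => (hasIDP_smul_prismPolytope_iff hn (by lia)).2 (by lia)
  · rintro k ⟨hk, h⟩
    exact (hasIDP_smul_prismPolytope_iff hn hk).1 (h k le_rfl)
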